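/- Let $\mathbb{T}\subset\mathbb{C}$ be the unit circle, $A$ a finite alphabet, and $\{F_a : a\in A\}$ a family of Möbius transformations that map the closed unit disc onto itself. For a finite word $v=v_0\cdots v_{n-1}$ put $F_v=F_{v_0}\circ\cdots\circ F_{v_{n-1}}$. A sequence $(G_n)$ of such transformations *represents* $x\in\mathbb{T}$ if the image measures $G_n\mu$ of the uniform probability measure $\mu$ on $\mathbb{T}$ converge to the Dirac measure $\delta_x$ in the weak$^*$ topology. For $w\in A^{\omega}$ let $\Phi(w)=x$ if the sequence $(F_{w_{[0,n)}})_{n\ge 1}$ represents $x$; let $\mathbb{X}_F$ be the set of those $w$ for which such an $x$ exists. A subshift $\Sigma\subset A^\omega$ (a closed set with $\sigma(\Sigma)\subset\Sigma$, where $\sigma$ is the shift) is a *Möbius number system* for $\{F_a\}$ if $\Sigma\subset\mathbb{X}_F$, $\Phi(\Sigma)=\mathbb{T}$ and $\Phi|_\Sigma$ is continuous. Let $\mathcal{W}=\{W_a:a\in A\}$ be an *interval almost cover*, that is, each $W_a$ is a union of finitely many open intervals of $\mathbb{T}$ and $\bigcup_{a}\overline{W}_a=\mathbb{T}$. For $u=u_0\cdots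 u_{n-1}$ put $W_u=W_{u_0}\cap F_{u_0}(W_{u_1})\cap\cdots\cap F_{u_0\cdots u_{n-2}}(W_{u_{n-1}})$, and $W_\lambda=\mathbb{T}$ for the empty word $\lambda$. Let $\Sigma\subset A^\omega$ be a nonempty subshift, $\mathcal{L}(\Sigma)$ the set of finite factors (including $\lambda$) of words of $\Sigma$, and suppose that $\Sigma$ is *compatible* with $\mathcal{W}$: for every $v\in\mathcal{L}(\Sigma)$, $$\overline{W}_v=\bigcup_{a\in A,\ va\in\mathcal{L}(\Sigma)}\overline{W}_{va}.$$ Assume that $W_a\subset V_a:=\{x\in\mathbb{T}:|(F_a^{-1})'(x)|>1\}$ for every $a\in A$. Then the interval shift $$\Sigma_{\mathcal{W}}=\{w\in\Sigma : W_{w_{[0,n)}}\ne\emptyset\text{ for all }n\}$$ is a Möbius number system for $\{F_a:a\in A\}$. Moreover, for every finite word $v\in\mathcal{L}(\Sigma)$, $$\Phi([v]\cap\Sigma_{\mathcal{W}})=\overline{W}_v,$$ where $[v]$ is the set of infinite words with prefix $v$. -/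

import Mathlib

namespace Mobius

noncomputable section

open MeasureTheory Filter Topology

/-! ### Disc preserving Möbius transformations -/

/-- The closed unit disc, as a subset of the complex sphere `ℂ ∪ {∞}`. -/
def closedDisc : Set (OnePoint ℂ) :=
  (fun z : ℂ => (z : OnePoint ℂ)) '' Metric.closedBall (0 : ℂ) 1

open scoped Pointwise in
/-- The group of disc preserving Möbius transformations: regular complex matrices `g` whose
action on the complex sphere, `z ↦ (a z + b) / (c z + d)`, maps the closed unit disc onto itself.
(A transformation has several matrices; nothing below depends on the choice.) -/
def DiscMT : Subgroup (Matrix.GeneralLinearGroup (Fin 2) ℂ) :=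
  MulAction.stabilizer (Matrix.GeneralLinearGroup (Fin 2) ℂ) closedDisc

/-- The formula of a Möbius transformation on the finite points that are not its pole. -/
def mob (g : Matrix.GeneralLinearGroup (Fin 2) ℂ) (z : ℂ) : ℂ :=
  (g 0 0 * z + g 0 1) / (g 1 0 * z + g 1 1)

/-- A disc preserving transformation has no pole in the closed disc, and there it is given by its
formula, with values in the closed disc. -/
theorem discMT_spec (g : DiscMT) {z : ℂ} (hz : ‖z‖ ≤ 1) :
    g.1 1 0 * z + g.1 1 1 ≠ 0 ∧ g.1 • (z : OnePoint ℂ) = ((mob g.1 z : ℂ) : OnePoint ℂ) ∧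
      ‖mob g.1 z‖ ≤ 1 := by
  have hg : (fun p : OnePoint ℂ => g.1 • p) '' closedDisc = closedDisc := g.2
  have hmem : g.1 • (z : OnePoint ℂ) ∈ closedDisc := by
    rw [← hg]
    exact ⟨_, ⟨z, by simpa using hz, rfl⟩, rfl⟩
  obtain ⟨w, hw, hwz⟩ := hmem
  rw [OnePoint.smul_some_eq_ite] at hwz ⊢
  by_cases h : g.1 1 0 * z + g.1 1 1 = 0
  · simp [h] at hwz
  · simp only [h, if_false] at hwz ⊢
    have hw' : w = mob g.1 z := OnePoint.coe_injective hwz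
    refine ⟨h, rfl, ?_⟩
    rw [← hw']
    simpa using hw

/-- A disc preserving transformation maps the unit circle to itself. -/
theorem norm_mob_eq_one (g : DiscMT) {z : ℂ} (hz : ‖z‖ = 1) : ‖mob g.1 z‖ = 1 := by
  obtain ⟨-, h2, h3⟩ := discMT_spec g hz.le
  refine le_antisymm h3 (not_lt.1 fun hlt => ?_)
  set w := mob g.1 z with hw
  obtain ⟨k1, k2, -⟩ := discMT_spec g⁻¹ h3
  have hwz : mob (g⁻¹).1 w = z := by
    apply OnePoint.coe_injective
    rw [← k2, ← h2]
    exact inv_smul_smul g.1 _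
  have hdet : (g⁻¹).1 0 0 * (g⁻¹).1 1 1 - (g⁻¹).1 0 1 * (g⁻¹).1 1 0 ≠ 0 := by
    rw [← Matrix.det_fin_two]
    exact Matrix.GeneralLinearGroup.det_ne_zero _
  have hd : HasStrictDerivAt (mob (g⁻¹).1)
      (((g⁻¹).1 0 0 * ((g⁻¹).1 1 0 * w + (g⁻¹).1 1 1)
        - ((g⁻¹).1 0 0 * w + (g⁻¹).1 0 1) * (g⁻¹).1 1 0)
        / ((g⁻¹).1 1 0 * w + (g⁻¹).1 1 1) ^ 2) w := by
    have e1 : HasStrictDerivAt (fun x : ℂ => (g⁻¹).1 0 0 * x + (g⁻¹).1 0 1) ((g⁻¹).1 0 0) w := by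
      simpa using ((hasStrictDerivAt_id w).const_mul ((g⁻¹).1 0 0)).add_const ((g⁻¹).1 0 1)
    have e2 : HasStrictDerivAt (fun x : ℂ => (g⁻¹).1 1 0 * x + (g⁻¹).1 1 1) ((g⁻¹).1 1 0) w := by
      simpa using ((hasStrictDerivAt_id w).const_mul ((g⁻¹).1 1 0)).add_const ((g⁻¹).1 1 1)
    exact e1.fun_div e2 k1
  have hmap := hd.map_nhds_eq (by
    refine div_ne_zero ?_ (pow_ne_zero _ k1)
    convert hdet using 1
    ring)
  rw [hwz] at hmap
  have hin : Metric.closedBall (0 : ℂ) 1 ∈ 𝓝 z := by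
    rw [← hmap, mem_map]
    filter_upwards [Metric.isOpen_ball.mem_nhds (show w ∈ Metric.ball (0 : ℂ) 1 by simpa using hlt)]
      with x hx
    have hx' : ‖x‖ ≤ 1 := by
      have : ‖x‖ < 1 := by simpa using hx
      exact this.le
    simpa using (discMT_spec g⁻¹ hx').2.2
  have := mem_interior_iff_mem_nhds.2 hin
  rw [interior_closedBall _ one_ne_zero] at this
  simp [hz] at this

/-- The action of a disc preserving Möbius transformation on the unit circle. -/
def onCircle (g : DiscMT) (z : Circle) : Circle :=
  ⟨mob g.1 (z : ℂ), mem_sphere_zero_iff_norm.2 (norm_mob_eq_one g z.norm_coe)⟩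

/-- The expansion interval of `g⁻¹`: the set of points `x` of the circle at which
`|(g⁻¹)'(x)| > 1`. -/
def expansionInterval (g : DiscMT) : Set Circle :=
  {x | 1 < ‖deriv (mob (g⁻¹).1) (x : ℂ)‖}

/-! ### Representation of points by sequences of transformations -/

instance : MeasurableSpace Circle := borel Circle

instance : BorelSpace Circle := ⟨rfl⟩

/-- The uniform probability measure on the circle. -/
def uniform : Measure Circle :=
  (ENNReal.ofReal (2 * Real.pi))⁻¹ •
    Measure.map (fun t : ℝ => Circle.exp t) (volume.restrict (Set.Ioc (-Real.pi) Real.pi))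

/-- The sequence `G` represents the point `x`: the images of the uniform measure under `G n`
converge to the Dirac measure at `x` in the weak* topology. -/
def Represents (G : ℕ → DiscMT) (x : Circle) : Prop :=
  ∀ f : C(Circle, ℝ), Tendsto (fun n => ∫ z, f z ∂(uniform.map (onCircle (G n)))) atTop
    (𝓝 (∫ z, f z ∂(Measure.dirac x)))

/-- A sequence represents at most one point. -/
theorem Represents.unique {G : ℕ → DiscMT} {x y : Circle} (hx : Represents G x)
    (hy : Represents G y) : x = y := by
  have h := tendsto_nhds_unique (hx ⟨fun z => dist z y, by fun_prop⟩)
    (hy ⟨fun z => dist z y, by fun_prop⟩)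
  simpa using h

/-! ### Words and subshifts -/

variable {A : Type*}

/-- The prefix of length `n` of an infinite word. -/
def pre (w : ℕ → A) (n : ℕ) : List A := (List.range n).map w

/-- The shift map. -/
def shift (w : ℕ → A) : ℕ → A := fun i => w (i + 1)

/-- The infinite words that begin with the finite word `v`. -/
def cylinder (v : List A) : Set (ℕ → A) := {w | pre w v.length = v}

/-- A subshift: a closed set of infinite words (in the product topology, the alphabet being
discrete) that is mapped into itself by the shift. -/
def IsSubshift [TopologicalSpace A] (S : Set (ℕ → A)) : Prop :=
  IsClosed S ∧ Set.MapsTo shift S S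

/-- The language of `S`: the finite words (the empty one included) that are factors of words
in `S`. -/
def language (S : Set (ℕ → A)) : Set (List A) :=
  {v | ∃ w ∈ S, ∃ i n : ℕ, v = pre (fun j => w (i + j)) n}

/-! ### Möbius number systems -/

/-- The composition `F_{v_0} ∘ F_{v_1} ∘ ⋯ ∘ F_{v_{n-1}}` for a finite word `v`. -/
def wordMT (F : A → DiscMT) (v : List A) : DiscMT := (v.map F).prod

/-- The domain of `Φ`: the infinite words `w` for which the sequence `F_{w_{[0,n)}}` represents
some point. -/
def domain (F : A → DiscMT) : Set (ℕ → A) :=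
  {w | ∃ x, Represents (fun n => wordMT F (pre w n)) x}

open scoped Classical in
/-- `Φ w` is the point represented by the sequence `F_{w_{[0,n)}}` (and the arbitrary value `1`
outside the domain of `Φ`). -/
def Phi (F : A → DiscMT) (w : ℕ → A) : Circle :=
  if h : w ∈ domain F then h.choose else 1

/-- `S` is a Möbius number system for the iterative system `F`. -/
def IsNumberSystem [TopologicalSpace A] (F : A → DiscMT) (S : Set (ℕ → A)) : Prop :=
  IsSubshift S ∧ S ⊆ domain F ∧ Phi F '' S = Set.univ ∧ ContinuousOn (Phi F) S

/-! ### Interval almost covers -/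

/-- Open intervals `(x, y)`, `x ≠ y`, of the circle: the points met strictly between `x` and `y`
on the way from `x` to `y` in the counterclockwise direction. -/
def IsOpenInterval (I : Set Circle) : Prop :=
  ∃ a b : ℝ, a < b ∧ b < a + 2 * Real.pi ∧ I = (fun t : ℝ => Circle.exp t) '' Set.Ioo a b

/-- An interval almost cover: every `W a` is a union of finitely many (possibly no) open intervals,
and the closures of the `W a` cover the circle. -/
def IsIntervalAlmostCover (W : A → Set Circle) : Prop :=
  (⋃ a, closure (W a)) = Set.univ ∧
    ∀ a, ∃ s : Set (Set Circle), s.Finite ∧ (∀ I ∈ s, IsOpenInterval I) ∧ W a = ⋃₀ s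

/-- The refined set `W_u = W_{u_0} ∩ F_{u_0}(W_{u_1}) ∩ ⋯ ∩ F_{u_{[0,n-1)}}(W_{u_{n-1}})` of a word
`u` of length `n`; it is the whole circle for the empty word. -/
def refined (F : A → DiscMT) (W : A → Set Circle) (u : List A) : Set Circle :=
  ⋂ i : Fin u.length, onCircle (wordMT F (u.take i)) '' W (u.get i)

/-- The subshift `S` is compatible with `W`. -/
def IsCompatible (F : A → DiscMT) (W : A → Set Circle) (S : Set (ℕ → A)) : Prop :=
  ∀ v ∈ language S,
    closure (refined F W v) =
      ⋃ a ∈ {a : A | v ++ [a] ∈ language S}, closure (refined F W (v ++ [a]))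

/-- The interval shift corresponding to `S` and `W`. -/
def intervalShift (F : A → DiscMT) (W : A → Set Circle) (S : Set (ℕ → A)) : Set (ℕ → A) :=
  {w | w ∈ S ∧ ∀ n, (refined F W (pre w n)).Nonempty}

end

end Mobius

namespace Mobius

open MeasureTheory Filter Topology

/-! Fix a word `w`, put G_n = F_{w_{[0,n)}}, and let x lie in every closure of W_{w_{[0,n)}}.
Everything reduces to G_n(0) → x (`tendsto_of_mem_closure_refined`), which by the mean value
property means that `w` represents x (`represents_of_tendsto`).

The points x_i = G_i⁻¹ x lie in the closures of W_{w_i}, so K_n = |(G_n⁻¹)'(x)| is a product of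
factors ≥ 1. If K_n → ∞, then ‖x - G_n(0)‖² K_n ≤ 1 suffices (`norm_sub_mob_zero_sq_le`). Otherwise
the factors tend to 1. Each letter has finitely many points of dilation 1, which forces the factors
to equal 1 eventually (`eventually_dil_eq_one`). From then on each letter acts as a translation in
coordinates sending x_i to infinity. Points of W_u near x show that the translations share a sign,
and finiteness of the alphabet bounds them away from 0; their sum diverges and again G_n(0) → x
(`tendsto_of_dil_eq_one`).

Thus Φ(w) is the only common point of the closed refined sets; compactness gives existence and
continuity. Compatibility lets a word be extended letter by letter while x stays in the closures,
which gives the images of cylinders and, for v = λ, surjectivity. -/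

/-! ### Algebra of disc preserving transformations -/

/-- The denominator of a Möbius transformation. -/
noncomputable def denom (g : DiscMT) (z : ℂ) : ℂ := g.1 1 0 * z + g.1 1 1

/-- The determinant of the matrix of a disc preserving transformation. -/
noncomputable def disc (g : DiscMT) : ℂ := g.1 0 0 * g.1 1 1 - g.1 0 1 * g.1 1 0

theorem denom_ne_zero (g : DiscMT) {z : ℂ} (hz : ‖z‖ ≤ 1) : denom g z ≠ 0 :=
  (discMT_spec g hz).1

theorem disc_ne_zero (g : DiscMT) : disc g ≠ 0 := by
  have := Matrix.GeneralLinearGroup.det_ne_zero g.1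
  rwa [Matrix.det_fin_two] at this

theorem mob_eq (g : DiscMT) (z : ℂ) : mob g.1 z = (g.1 0 0 * z + g.1 0 1) / denom g z := rfl

theorem norm_mob_le (g : DiscMT) {z : ℂ} (hz : ‖z‖ ≤ 1) : ‖mob g.1 z‖ ≤ 1 :=
  (discMT_spec g hz).2.2

theorem mob_mul (g h : DiscMT) {z : ℂ} (hz : ‖z‖ ≤ 1) :
    mob (g * h).1 z = mob g.1 (mob h.1 z) := by
  apply OnePoint.coe_injective
  rw [← (discMT_spec (g * h) hz).2.1, ← (discMT_spec g (norm_mob_le h hz)).2.1,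
    ← (discMT_spec h hz).2.1, ← mul_smul]
  rfl

theorem mob_one (z : ℂ) : mob (1 : DiscMT).1 z = z := by
  simp [mob]

theorem mob_inv_mob (g : DiscMT) {z : ℂ} (hz : ‖z‖ ≤ 1) : mob (g⁻¹).1 (mob g.1 z) = z := by
  have := mob_mul g⁻¹ g hz
  rw [inv_mul_cancel, mob_one] at this
  exact this.symm

theorem mob_mob_inv (g : DiscMT) {z : ℂ} (hz : ‖z‖ ≤ 1) : mob g.1 (mob (g⁻¹).1 z) = z := by
  have := mob_mul g g⁻¹ hz
  rw [mul_inv_cancel, mob_one] at this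
  exact this.symm

theorem hasDerivAt_mob (g : DiscMT) {z : ℂ} (hz : ‖z‖ ≤ 1) :
    HasDerivAt (mob g.1) (disc g / denom g z ^ 2) z := by
  have e0 := denom_ne_zero g hz
  have e1 : HasDerivAt (fun x : ℂ => g.1 0 0 * x + g.1 0 1) (g.1 0 0) z := by
    simpa using ((hasDerivAt_id z).const_mul (g.1 0 0)).add_const (g.1 0 1)
  have e2 : HasDerivAt (fun x : ℂ => g.1 1 0 * x + g.1 1 1) (g.1 1 0) z := by
    simpa using ((hasDerivAt_id z).const_mul (g.1 1 0)).add_const (g.1 1 1)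
  refine (e1.fun_div e2 e0).congr_deriv ?_
  rw [denom] at e0 ⊢
  rw [disc]
  ring

theorem continuousOn_mob (g : DiscMT) : ContinuousOn (mob g.1) (Metric.closedBall 0 1) :=
  fun _ hz => (hasDerivAt_mob g (by simpa using hz)).continuousAt.continuousWithinAt

theorem deriv_mob (g : DiscMT) {z : ℂ} (hz : ‖z‖ ≤ 1) :
    deriv (mob g.1) z = disc g / denom g z ^ 2 :=
  (hasDerivAt_mob g hz).deriv

/-- The dilation factor of a transformation at a point. -/
noncomputable def dil (g : DiscMT) (z : ℂ) : ℝ := ‖deriv (mob g.1) z‖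

theorem dil_eq (g : DiscMT) {z : ℂ} (hz : ‖z‖ ≤ 1) : dil g z = ‖disc g‖ / ‖denom g z‖ ^ 2 := by
  rw [dil, deriv_mob g hz, norm_div, norm_pow]

theorem dil_pos (g : DiscMT) {z : ℂ} (hz : ‖z‖ ≤ 1) : 0 < dil g z := by
  rw [dil_eq g hz]
  have := norm_pos_iff.2 (denom_ne_zero g hz)
  have := norm_pos_iff.2 (disc_ne_zero g)
  positivity

theorem denom_mul (g h : DiscMT) {z : ℂ} (hz : ‖z‖ ≤ 1) :
    denom (g * h) z = denom g (mob h.1 z) * denom h z := by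
  have h0 := denom_ne_zero h hz
  rw [denom, denom, mob_eq, add_mul, mul_div_assoc', div_mul_cancel₀ _ h0, denom]
  simp only [Subgroup.coe_mul, Units.val_mul, Matrix.mul_apply, Fin.sum_univ_two]
  ring

theorem disc_mul (g h : DiscMT) : disc (g * h) = disc g * disc h := by
  simp only [disc, Subgroup.coe_mul, Units.val_mul, Matrix.mul_apply, Fin.sum_univ_two]
  ring

theorem dil_mul (g h : DiscMT) {z : ℂ} (hz : ‖z‖ ≤ 1) :
    dil (g * h) z = dil g (mob h.1 z) * dil h z := by
  rw [dil_eq _ hz, dil_eq _ hz, dil_eq _ (norm_mob_le h hz), denom_mul g h hz, disc_mul]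
  simp only [norm_mul, mul_pow]
  rw [div_mul_div_comm]

theorem dil_one {z : ℂ} (hz : ‖z‖ ≤ 1) : dil 1 z = 1 := by
  rw [dil_eq _ hz]
  simp [disc, denom]

theorem dil_inv_mob (g : DiscMT) {z : ℂ} (hz : ‖z‖ ≤ 1) :
    dil g⁻¹ (mob g.1 z) * dil g z = 1 := by
  rw [← dil_mul _ _ hz, inv_mul_cancel, dil_one hz]

theorem mob_sub_mob (g : DiscMT) {z w : ℂ} (hz : ‖z‖ ≤ 1) (hw : ‖w‖ ≤ 1) :
    mob g.1 z - mob g.1 w = disc g * (z - w) / (denom g z * denom g w) := by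
  have h1 := denom_ne_zero g hz
  have h2 := denom_ne_zero g hw
  rw [mob_eq, mob_eq, div_sub_div _ _ h1 h2]
  congr 1
  simp only [disc, denom]
  ring

/-- The modulus of the difference quotient is exactly the geometric mean of the moduli of the two
derivatives. All later distance estimates rest on this. -/
theorem norm_mob_sub_mob_sq (g : DiscMT) {z w : ℂ} (hz : ‖z‖ ≤ 1) (hw : ‖w‖ ≤ 1) :
    ‖mob g.1 z - mob g.1 w‖ ^ 2 = dil g z * dil g w * ‖z - w‖ ^ 2 := by
  rw [mob_sub_mob g hz hw, dil_eq g hz, dil_eq g hw]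
  simp only [norm_mul, norm_div]
  ring

/-! ### The normal form -/

open ComplexConjugate in
/-- The matrix of a disc preserving transformation is a multiple of a matrix of `SU(1,1)`. -/
theorem exists_normal_form (g : DiscMT) :
    ∃ (ω : ℂ) (r : ℝ), 0 < r ∧ r = ‖g.1 1 1‖ ^ 2 - ‖g.1 1 0‖ ^ 2 ∧ ‖ω‖ = 1 ∧ disc g = ω * r ∧
      g.1 0 0 = ω * conj (g.1 1 1) ∧ g.1 0 1 = ω * conj (g.1 1 0) := by
  have key : ∀ z : ℂ, ‖z‖ = 1 →
      Complex.normSq (g.1 0 0 * z + g.1 0 1) = Complex.normSq (g.1 1 0 * z + g.1 1 1) := by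
    intro z hz
    have h1 := norm_mob_eq_one g hz
    have h2 := denom_ne_zero g hz.le
    rw [mob_eq, norm_div, div_eq_one_iff_eq (norm_ne_zero_iff.2 h2), denom] at h1
    rw [Complex.normSq_eq_norm_sq, Complex.normSq_eq_norm_sq, h1]
  have hD := disc_ne_zero g
  have hd : g.1 1 1 ≠ 0 := by simpa [denom] using denom_ne_zero g (z := 0) (by simp)
  -- Otherwise the pole -d/c would lie in the closed disc.
  have hcd : ‖g.1 1 0‖ < ‖g.1 1 1‖ := by
    by_contra! hle
    have hc : g.1 1 0 ≠ 0 := by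
      rintro hc
      rw [hc] at hle
      exact hd (by simpa using hle)
    refine denom_ne_zero g (z := -(g.1 1 1) / g.1 1 0) ?_ ?_
    · rw [norm_div, norm_neg]
      exact div_le_one_of_le₀ hle (norm_nonneg _)
    · rw [denom]; field_simp; ring
  rw [disc] at hD ⊢
  generalize g.1 0 0 = a at *
  generalize g.1 0 1 = b at *
  generalize g.1 1 0 = c at *
  generalize g.1 1 1 = d at *
  -- On the circle |az+b|² - |cz+d|² is a trigonometric polynomial of degree one, so three points
  -- determine its coefficients.
  have k1 := key 1 (by simp)
  have k2 := key (-1) (by simp)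
  have k3 := key Complex.I (by simp)
  simp only [Complex.normSq_apply, Complex.add_re, Complex.add_im, Complex.mul_re, Complex.mul_im,
    Complex.I_re, Complex.I_im, Complex.neg_re, Complex.neg_im, Complex.one_re, Complex.one_im]
    at k1 k2 k3
  have hab : a * conj b = c * conj d := by
    apply Complex.ext
    · simp; linarith
    · simp; linarith
  have hsum : ‖a‖ ^ 2 + ‖b‖ ^ 2 = ‖c‖ ^ 2 + ‖d‖ ^ 2 := by
    simp only [← Complex.normSq_eq_norm_sq, Complex.normSq_apply]
    linarith
  have cd (z : ℂ) : z * conj z = ((‖z‖ ^ 2 : ℝ) : ℂ) := by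
    rw [Complex.mul_conj, Complex.normSq_eq_norm_sq]
  set R : ℝ := ‖d‖ ^ 2 - ‖b‖ ^ 2 with hR
  have e1 : (a * d - b * c) * conj d = a * R := by
    rw [hR]; push_cast
    have h1 := cd d
    have h2 := cd b
    push_cast at h1 h2
    linear_combination a * h1 + b * hab - a * h2
  have e2 : (a * d - b * c) * conj b = c * R := by
    rw [hR]; push_cast
    have h1 := cd d
    have h2 := cd b
    push_cast at h1 h2
    linear_combination d * hab - c * h2 + c * h1
  have n1 : ‖a * d - b * c‖ ^ 2 * ‖d‖ ^ 2 = ‖a‖ ^ 2 * R ^ 2 := by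
    have := congrArg (fun z : ℂ => ‖z‖ ^ 2) e1
    simpa [mul_pow] using this
  have n2 : ‖a * d - b * c‖ ^ 2 * ‖b‖ ^ 2 = ‖c‖ ^ 2 * R ^ 2 := by
    have := congrArg (fun z : ℂ => ‖z‖ ^ 2) e2
    simpa [mul_pow] using this
  have hR0 : R ≠ 0 := by
    intro h
    rw [h] at e1
    simp [hD, hd] at e1
  -- Subtract `n2` from `n1` and use |a|² - |c|² = R = |d|² - |b|².
  have hDR : ‖a * d - b * c‖ ^ 2 = R ^ 2 := by
    have : (‖a * d - b * c‖ ^ 2 - R ^ 2) * R = 0 := by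
      have h1 : ‖a‖ ^ 2 = R + ‖c‖ ^ 2 := by rw [hR]; linarith
      rw [h1] at n1
      linear_combination n1 - n2 + ‖a * d - b * c‖ ^ 2 * hR
    rcases mul_eq_zero.1 this with h | h
    · linarith
    · exact absurd h hR0
  have hbc : ‖b‖ ^ 2 = ‖c‖ ^ 2 := by
    rw [hDR, mul_comm] at n2
    exact mul_right_cancel₀ (pow_ne_zero 2 hR0) n2
  have hRpos : 0 < R := by
    rw [hR, hbc]
    have := pow_lt_pow_left₀ hcd (norm_nonneg _) two_ne_zero
    linarith
  have hRc : (R : ℂ) ≠ 0 := by exact_mod_cast hR0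
  have hω : ‖(a * d - b * c) / R‖ = 1 := by
    rw [norm_div, Complex.norm_real, Real.norm_of_nonneg hRpos.le, div_eq_one_iff_eq hR0]
    exact (pow_left_inj₀ (norm_nonneg _) hRpos.le two_ne_zero).1 hDR
  have hωc : (a * d - b * c) / R * conj ((a * d - b * c) / R) = 1 := by
    rw [cd, hω]; simp
  have hcω : c = (a * d - b * c) / R * conj b := by
    rw [div_mul_eq_mul_div, e2]; field_simp
  refine ⟨(a * d - b * c) / R, R, hRpos, by rw [hR, hbc], hω, by field_simp, ?_, ?_⟩
  · rw [div_mul_eq_mul_div, e1]; field_simp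
  · have := congrArg conj hcω
    rw [map_mul, Complex.conj_conj] at this
    rw [this]
    linear_combination (-b) * hωc

/-! ### The action on the circle -/

theorem continuous_circle_coe : Continuous fun z : Circle => (z : ℂ) := continuous_subtype_val

theorem circle_dist_eq (x y : Circle) : dist x y = ‖(x : ℂ) - y‖ :=
  (Subtype.dist_eq _ _).trans (dist_eq_norm _ _)

@[simp] theorem coe_onCircle (g : DiscMT) (z : Circle) : (onCircle g z : ℂ) = mob g.1 z := rfl

theorem onCircle_mul (g h : DiscMT) (z : Circle) :
    onCircle (g * h) z = onCircle g (onCircle h z) :=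
  Circle.ext (mob_mul g h z.norm_coe.le)

theorem onCircle_one (z : Circle) : onCircle 1 z = z := Circle.ext (mob_one z)

theorem onCircle_inv_onCircle (g : DiscMT) (z : Circle) : onCircle g⁻¹ (onCircle g z) = z :=
  Circle.ext (mob_inv_mob g z.norm_coe.le)

theorem onCircle_onCircle_inv (g : DiscMT) (z : Circle) : onCircle g (onCircle g⁻¹ z) = z :=
  Circle.ext (mob_mob_inv g z.norm_coe.le)

theorem continuous_onCircle (g : DiscMT) : Continuous (onCircle g) := by
  refine Continuous.subtype_mk ?_ _
  exact (continuousOn_mob g).comp_continuous continuous_circle_coe fun z => by simpa using z.norm_coe.le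

/-- The homeomorphism of the circle induced by a disc preserving transformation. -/
noncomputable def circleHomeo (g : DiscMT) : Circle ≃ₜ Circle where
  toFun := onCircle g
  invFun := onCircle g⁻¹
  left_inv := onCircle_inv_onCircle g
  right_inv := onCircle_onCircle_inv g
  continuous_toFun := continuous_onCircle g
  continuous_invFun := continuous_onCircle g⁻¹

theorem mem_image_onCircle (g : DiscMT) (s : Set Circle) (z : Circle) :
    z ∈ onCircle g '' s ↔ onCircle g⁻¹ z ∈ s := by
  constructor
  · rintro ⟨y, hy, rfl⟩
    rwa [onCircle_inv_onCircle]
  · exact fun h => ⟨_, h, onCircle_onCircle_inv g z⟩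

theorem closure_image_onCircle (g : DiscMT) (s : Set Circle) :
    closure (onCircle g '' s) = onCircle g '' closure s :=
  ((circleHomeo g).image_closure s).symm

theorem dist_onCircle_sq (g : DiscMT) (x y : Circle) :
    dist (onCircle g x) (onCircle g y) ^ 2 = dil g x * dil g y * dist x y ^ 2 := by
  rw [circle_dist_eq, circle_dist_eq]
  exact norm_mob_sub_mob_sq g x.norm_coe.le y.norm_coe.le

/-! ### Dilation -/

theorem continuous_dil (g : DiscMT) : Continuous fun z : Circle => dil g z := by
  have : (fun z : Circle => dil g z) = fun z : Circle => ‖disc g‖ / ‖denom g z‖ ^ 2 :=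
    funext fun z => dil_eq g z.norm_coe.le
  rw [this]
  have hc : Continuous fun z : Circle => denom g z := by
    unfold denom
    fun_prop
  exact continuous_const.div (hc.norm.pow 2)
    fun z => pow_ne_zero 2 (norm_ne_zero_iff.2 (denom_ne_zero g z.norm_coe.le))

/-- By the normal form the value is 1 - |c/d|². -/
theorem dil_zero_le_one (g : DiscMT) : dil g 0 ≤ 1 := by
  obtain ⟨ω, r, hr, hr', hω, hD, -, -⟩ := exists_normal_form g
  have h0 : denom g 0 = g.1 1 1 := by simp [denom]
  rw [dil_eq g (by simp), hD, norm_mul, hω, one_mul, Complex.norm_real, Real.norm_of_nonneg hr.le,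
    h0]
  refine div_le_one_of_le₀ ?_ (by positivity)
  rw [hr']
  linarith [sq_nonneg ‖g.1 1 0‖]

/-- The distance identity at g⁻¹x and 0 gives ‖x - g(0)‖² = `dil g (g⁻¹x)` · `dil g 0`, and the
first factor is the inverse of `dil g⁻¹ x`. Strong expansion of g⁻¹ at x thus pulls g(0) towards x.
-/
theorem norm_sub_mob_zero_sq_le (g : DiscMT) (x : Circle) :
    ‖(x : ℂ) - mob g.1 0‖ ^ 2 * dil g⁻¹ x ≤ 1 := by
  have hy : mob g.1 (mob (g⁻¹).1 x) = x := mob_mob_inv g x.norm_coe.le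
  have hyn : ‖mob (g⁻¹).1 (x : ℂ)‖ = 1 := norm_mob_eq_one g⁻¹ x.norm_coe
  have h1 := norm_mob_sub_mob_sq g hyn.le (w := 0) (by simp)
  have h2 := dil_inv_mob g hyn.le
  rw [hy] at h1 h2
  rw [h1, sub_zero, hyn]
  have := dil_zero_le_one g
  calc _ = dil g⁻¹ x * dil g (mob (g⁻¹).1 x) * dil g 0 := by ring
    _ ≤ 1 := by rw [h2, one_mul]; exact this

open ComplexConjugate in
theorem normSq_denom (g : DiscMT) (z : Circle) :
    ‖denom g z‖ ^ 2 = ‖g.1 1 0‖ ^ 2 + ‖g.1 1 1‖ ^ 2 + 2 * (g.1 1 0 * z * conj (g.1 1 1)).re := by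
  rw [← Complex.normSq_eq_norm_sq, ← Complex.normSq_eq_norm_sq, ← Complex.normSq_eq_norm_sq,
    denom, Complex.normSq_add, map_mul, Circle.normSq_coe, mul_one]

open ComplexConjugate in
theorem dil_eq_one_iff (g : DiscMT) (z : Circle) :
    dil g z = 1 ↔ (g.1 1 0 * z * conj (g.1 1 1)).re = -‖g.1 1 0‖ ^ 2 := by
  obtain ⟨ω, r, hr, hr', hω, hD, -, -⟩ := exists_normal_form g
  have h := denom_ne_zero g z.norm_coe.le
  rw [dil_eq g z.norm_coe.le, hD, norm_mul, hω, one_mul, Complex.norm_real,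
    Real.norm_of_nonneg hr.le, div_eq_one_iff_eq (pow_ne_zero 2 (norm_ne_zero_iff.2 h)),
    normSq_denom, hr']
  constructor <;> intro h <;> linarith

theorem dil_eq_one_of_apply_zero (g : DiscMT) (h : g.1 1 0 = 0) (z : Circle) : dil g z = 1 := by
  rw [dil_eq_one_iff, h]
  simp

-- On the circle conj z = 1/z, so multiplying the condition of `dil_eq_one_iff` by z yields a
-- nonzero quadratic equation.
open ComplexConjugate Polynomial in
theorem finite_dil_eq_one (g : DiscMT) (h : g.1 1 0 ≠ 0) : {z : Circle | dil g z = 1}.Finite := by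
  have hd : g.1 1 1 ≠ 0 := by simpa [denom] using denom_ne_zero g (z := 0) (by simp)
  set c := g.1 1 0
  set d := g.1 1 1
  let p : ℂ[X] := C (c * conj d) * X ^ 2 + C (2 * (‖c‖ : ℂ) ^ 2) * X + C (conj c * d)
  have hp : p ≠ 0 := by
    intro hp
    have := congrArg (fun q => Polynomial.eval 0 q) hp
    simp [p, h, hd] at this
  refine ((Polynomial.finite_setOfPred_isRoot hp).preimage
    (f := fun z : Circle => (z : ℂ)) Circle.coe_injective.injOn).subset ?_
  intro z hz
  rw [Set.mem_ofPred_eq, dil_eq_one_iff] at hz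
  have h1 : c * z * conj d + conj (c * z * conj d) = -2 * (‖c‖ : ℂ) ^ 2 := by
    rw [Complex.add_conj, hz]
    push_cast
    ring
  have hzz : (z : ℂ) * conj (z : ℂ) = 1 := by rw [Complex.mul_conj, Circle.normSq_coe]; simp
  simp only [map_mul, Complex.conj_conj] at h1
  show p.IsRoot (z : ℂ)
  simp only [p, IsRoot.def, eval_add, eval_mul, eval_C, eval_X, eval_pow]
  linear_combination (z : ℂ) * h1 - conj c * d * hzz

/-! ### Parabolic coordinates -/

/-- A horizontal coordinate on the circle without the point `x`, which becomes the point at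
infinity. -/
noncomputable def tau (x z : Circle) : ℝ := ((x : ℂ) / (x - z)).im

/-- For |z| = 1 the number u = x/(x - z) satisfies |u| = |u - 1|, hence Re u = 1/2: the circle
without x becomes a vertical line with coordinate `tau`. -/
theorem inv_dist_sq (x z : Circle) (h : z ≠ x) : (dist x z ^ 2)⁻¹ = 1 / 4 + tau x z ^ 2 := by
  have hxz : (x : ℂ) - z ≠ 0 := sub_ne_zero.2 fun e => h (Circle.ext e.symm)
  have h1 : ‖(x : ℂ) / (x - z)‖ ^ 2 = (dist x z ^ 2)⁻¹ := by
    rw [norm_div, x.norm_coe, circle_dist_eq, one_div, inv_pow]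
  have h2 : ‖(x : ℂ) / (x - z) - 1‖ ^ 2 = (dist x z ^ 2)⁻¹ := by
    rw [div_sub_one hxz, norm_div, sub_sub_cancel, z.norm_coe, circle_dist_eq,
      one_div, inv_pow]
  rw [← h1]
  rw [← h1, ← Complex.normSq_eq_norm_sq, ← Complex.normSq_eq_norm_sq, Complex.normSq_apply,
    Complex.normSq_apply] at h2
  simp only [Complex.sub_re, Complex.sub_im, Complex.one_re, Complex.one_im] at h2
  have h3 : ((x : ℂ) / (x - z)).re = 1 / 2 := by linarith
  rw [← Complex.normSq_eq_norm_sq, Complex.normSq_apply, h3, tau]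
  ring

open ComplexConjugate in
/-- A transformation with dilation factor one at a point acts as a translation in the
coordinates that send the point and its image to infinity. -/
theorem exists_translation (g : DiscMT) (y : Circle) (h : dil g y = 1) :
    ∃ t : ℝ, ∀ z : ℂ, ‖z‖ ≤ 1 → z ≠ y →
      mob g.1 y / (mob g.1 y - mob g.1 z) = y / (y - z) + t * Complex.I := by
  have hc := (dil_eq_one_iff g y).1 h
  obtain ⟨ω, r, hr, hr', hω, hD, ha, hb⟩ := exists_normal_form g
  have hJ := normSq_denom g y
  rw [hc] at hJ
  have hJr : denom g y * conj (denom g y) = r := by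
    rw [Complex.mul_conj, Complex.normSq_eq_norm_sq, hJ, hr']
    congr 1
    ring
  have hyy : (y : ℂ) * conj (y : ℂ) = 1 := by rw [Complex.mul_conj, Circle.normSq_coe]; simp
  have hy0 := denom_ne_zero g y.norm_coe.le
  have hnum : mob g.1 y * denom g y = ω * y * conj (denom g y) := by
    rw [mob_eq, div_mul_cancel₀ _ hy0, ha, hb, denom, map_add, map_mul]
    linear_combination (-ω * conj (g.1 1 0)) * hyy
  have hre : (y * conj (denom g y) * g.1 1 0).re = 0 := by
    have : y * conj (denom g y) * g.1 1 0
        = ((‖g.1 1 0‖ ^ 2 : ℝ) : ℂ) + g.1 1 0 * y * conj (g.1 1 1) := by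
      rw [← Complex.normSq_eq_norm_sq, ← Complex.mul_conj, denom, map_add, map_mul]
      linear_combination (g.1 1 0 * conj (g.1 1 0)) * hyy
    rw [this, Complex.add_re, Complex.ofReal_re, hc]
    ring
  have him : y * conj (denom g y) * g.1 1 0
      = ((y * conj (denom g y) * g.1 1 0).im : ℂ) * Complex.I := by
    apply Complex.ext <;> simp [hre]
  -- With J = `denom g y`, the left side expands to y|J|²/(r(y - z)) - y conj(J) c/r. Dilation 1 at
  -- y gives both |J|² = r and a purely imaginary second term.
  refine ⟨-(y * conj (denom g y) * g.1 1 0).im / r, fun z hz hzy => ?_⟩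
  have hω0 : ω ≠ 0 := norm_ne_zero_iff.1 (by rw [hω]; norm_num)
  have hrc : (r : ℂ) ≠ 0 := by exact_mod_cast hr.ne'
  have hyz : (y : ℂ) - z ≠ 0 := sub_ne_zero.2 hzy.symm
  have hz0 := denom_ne_zero g hz
  have hz1 : denom g z = denom g y - g.1 1 0 * (y - z) := by
    rw [denom, denom]
    ring
  push_cast
  rw [neg_div, neg_mul, div_mul_eq_mul_div, ← him, mob_sub_mob g y.norm_coe.le hz, hD]
  have e1 : mob g.1 y / (ω * r * (y - z) / (denom g y * denom g z))
      = (mob g.1 y * denom g y) * denom g z / (ω * r * (y - z)) := by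
    field_simp
  rw [e1, hnum, hz1]
  field_simp
  linear_combination hJr

/-- The translation length bounds the displacement of the centre of the disc. -/
theorem norm_mob_zero_le_of_translation {g : DiscMT} {y : Circle} {t : ℝ}
    (ht : ∀ z : ℂ, ‖z‖ ≤ 1 → z ≠ y →
      mob g.1 y / (mob g.1 y - mob g.1 z) = y / (y - z) + t * Complex.I) :
    ‖mob g.1 0‖ ≤ |t| := by
  have h := ht 0 (by simp) y.coe_ne_zero.symm
  rw [sub_zero, div_self y.coe_ne_zero] at h
  have hx : ‖mob g.1 y‖ = 1 := norm_mob_eq_one g y.norm_coe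
  have hne : mob g.1 y - mob g.1 0 ≠ 0 := by
    intro h0
    rw [h0, div_zero] at h
    have := congrArg Complex.re h
    simp at this
  rw [div_eq_iff hne] at h
  have e : mob g.1 0 * (1 + t * Complex.I) = mob g.1 y * (t * Complex.I) := by
    linear_combination h
  have e2 := congrArg norm e
  rw [norm_mul, norm_mul, hx, one_mul, norm_mul, Complex.norm_I, mul_one, Complex.norm_real,
    Real.norm_eq_abs] at e2
  have : 1 ≤ ‖(1 + t * Complex.I : ℂ)‖ := by
    have := Complex.abs_re_le_norm (1 + t * Complex.I : ℂ)
    simpa using this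
  rw [← e2]
  exact le_mul_of_one_le_right (norm_nonneg _) this

/-! ### Integration against the uniform measure -/

theorem integral_uniform {E : Type*} [NormedAddCommGroup E] [NormedSpace ℝ E] (f : Circle → E)
    (hf : Continuous f) :
    ∫ z, f z ∂uniform = (2 * Real.pi)⁻¹ • ∫ t in (0 : ℝ)..2 * Real.pi, f (Circle.exp t) := by
  have hper : Function.Periodic (fun t : ℝ => f (Circle.exp t)) (2 * Real.pi) := fun t => by
    simp
  have h1 := hper.intervalIntegral_add_eq (-Real.pi) 0
  rw [show -Real.pi + 2 * Real.pi = Real.pi by ring, zero_add] at h1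
  rw [uniform, integral_smul_measure, integral_map Circle.exp.continuous.aemeasurable
    hf.aestronglyMeasurable, ← intervalIntegral.integral_of_le (by linarith [Real.pi_pos]), h1]
  rw [ENNReal.toReal_inv, ENNReal.toReal_ofReal (by positivity)]

instance : IsProbabilityMeasure uniform := by
  constructor
  rw [uniform, Measure.smul_apply, Measure.map_apply Circle.exp.continuous.measurable .univ,
    Set.preimage_univ, Measure.restrict_apply_univ, Real.volume_Ioc, smul_eq_mul,
    show Real.pi - -Real.pi = 2 * Real.pi by ring]
  exact ENNReal.inv_mul_cancel (by simp [Real.pi_pos]) ENNReal.ofReal_ne_top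

/-- The mean value property. -/
theorem integral_onCircle (g : DiscMT) : ∫ z, (onCircle g z : ℂ) ∂uniform = mob g.1 0 := by
  have hd : DiffContOnCl ℂ (mob g.1) (Metric.ball 0 |1|) := by
    rw [abs_one]
    refine DifferentiableOn.diffContOnCl fun z hz => ?_
    rw [closure_ball _ one_ne_zero] at hz
    exact (hasDerivAt_mob g (by simpa using hz)).differentiableAt.differentiableWithinAt
  rw [integral_uniform (fun z => (onCircle g z : ℂ)) (continuous_circle_coe.comp (continuous_onCircle g)),
    ← hd.circleAverage, Real.circleAverage]
  simp [circleMap]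

/-- On the circle the squared distance to x is affine in the point, so its mean depends on g only
through g(0). -/
theorem integral_dist_sq (g : DiscMT) (x : Circle) :
    ∫ z, dist (onCircle g z) x ^ 2 ∂uniform
      = 2 * (1 - (mob g.1 0 * (starRingEnd ℂ) (x : ℂ)).re) := by
  have h1 (z : Circle) : dist (onCircle g z) x ^ 2
      = 2 - 2 * ((onCircle g z : ℂ) * (starRingEnd ℂ) (x : ℂ)).re := by
    rw [circle_dist_eq, ← Complex.normSq_eq_norm_sq, Complex.normSq_sub]
    simp only [Circle.normSq_coe]
    ring
  have hcont : Continuous fun z => (onCircle g z : ℂ) * (starRingEnd ℂ) (x : ℂ) :=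
    (continuous_circle_coe.comp (continuous_onCircle g)).mul continuous_const
  have hint : Integrable (fun z => (onCircle g z : ℂ) * (starRingEnd ℂ) (x : ℂ)) uniform :=
    hcont.integrable_of_hasCompactSupport (HasCompactSupport.of_compactSpace _)
  simp only [h1]
  have hre : Integrable (fun z => ((onCircle g z : ℂ) * (starRingEnd ℂ) (x : ℂ)).re) uniform :=
    hint.re
  rw [integral_sub (integrable_const _) (hre.const_mul 2), integral_const_mul]
  have := integral_re hint
  simp only [RCLike.re_eq_complex_re] at this
  rw [this, integral_mul_const, integral_onCircle]
  simp
  ring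

/-- If the images of the centre of the disc converge to `x`, the sequence represents `x`. -/
theorem represents_of_tendsto {G : ℕ → DiscMT} {x : Circle}
    (h : Tendsto (fun n => mob (G n).1 0) atTop (𝓝 (x : ℂ))) : Represents G x := by
  intro f
  rw [integral_dirac]
  have hI (n : ℕ) : ∫ z, f z ∂(uniform.map (onCircle (G n))) = ∫ z, f (onCircle (G n) z) ∂uniform :=
    integral_map (continuous_onCircle _).aemeasurable f.continuous.aestronglyMeasurable
  simp only [hI]
  have hd : Tendsto (fun n => ∫ z, dist (onCircle (G n) z) x ^ 2 ∂uniform) atTop (𝓝 0) := by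
    simp only [integral_dist_sq]
    have h1 : Tendsto (fun n => 2 * (1 - (mob (G n).1 0 * (starRingEnd ℂ) (x : ℂ)).re)) atTop
        (𝓝 (2 * (1 - ((x : ℂ) * (starRingEnd ℂ) (x : ℂ)).re))) :=
      (((Complex.continuous_re.tendsto _).comp (h.mul_const _)).const_sub 1).const_mul 2
    rw [Complex.mul_conj, Circle.normSq_coe] at h1
    simpa using h1
  rw [Metric.tendsto_atTop]
  intro ε hε
  obtain ⟨δ, hδ, hδf⟩ := Metric.continuous_iff.1 f.continuous x (ε / 2) (by positivity)
  -- Chebyshev: at distance ≥ δ from x, the trivial bound 2‖f‖ is at most C times the squared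
  -- distance.
  set C : ℝ := 2 * ‖f‖ / δ ^ 2 with hC
  have hC0 : 0 ≤ C := by positivity
  have hbound (z : Circle) : ‖f z - f x‖ ≤ ε / 2 + C * dist z x ^ 2 := by
    by_cases hz : dist z x < δ
    · have := (hδf z hz).le
      rw [dist_eq_norm] at this
      have : 0 ≤ C * dist z x ^ 2 := by positivity
      linarith
    · have h1 : ‖f z - f x‖ ≤ 2 * ‖f‖ := by
        calc _ ≤ ‖f z‖ + ‖f x‖ := norm_sub_le _ _
          _ ≤ _ := by linarith [f.norm_coe_le_norm z, f.norm_coe_le_norm x]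
      have h2 : δ ^ 2 ≤ dist z x ^ 2 := pow_le_pow_left₀ hδ.le (not_lt.1 hz) 2
      have h3 : 2 * ‖f‖ = C * δ ^ 2 := by rw [hC]; field_simp
      nlinarith
  have hev : ∀ᶠ n in atTop, C * ∫ z, dist (onCircle (G n) z) x ^ 2 ∂uniform < ε / 2 := by
    have := hd.const_mul C
    rw [mul_zero] at this
    exact this.eventually_lt_const (by positivity)
  obtain ⟨N, hN⟩ := eventually_atTop.1 hev
  refine ⟨N, fun n hn => ?_⟩
  have int_of {φ : Circle → ℝ} (hφ : Continuous φ) : Integrable φ uniform :=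
    hφ.integrable_of_hasCompactSupport (HasCompactSupport.of_compactSpace _)
  have hcg := continuous_onCircle (G n)
  have i1 : Integrable (fun z => f (onCircle (G n) z)) uniform := int_of (by fun_prop)
  have i2 : Integrable (fun z => C * dist (onCircle (G n) z) x ^ 2) uniform :=
    int_of (by fun_prop)
  have e : ∫ z, f (onCircle (G n) z) ∂uniform - f x
      = ∫ z, (f (onCircle (G n) z) - f x) ∂uniform := by
    rw [integral_sub i1 (integrable_const _)]
    simp
  rw [dist_eq_norm, e]
  calc _ ≤ ∫ z, (ε / 2 + C * dist (onCircle (G n) z) x ^ 2) ∂uniform :=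
        norm_integral_le_of_norm_le ((integrable_const _).add i2)
          (Eventually.of_forall fun z => hbound _)
    _ = ε / 2 + C * ∫ z, dist (onCircle (G n) z) x ^ 2 ∂uniform := by
        rw [integral_add (integrable_const _) i2, integral_const_mul]
        simp
    _ < ε := by linarith [hN n hn]

/-! ### Prefixes and trajectories -/

section Words

variable {A : Type*} (F : A → DiscMT) (W : A → Set Circle)

@[simp] theorem length_pre (w : ℕ → A) (n : ℕ) : (pre w n).length = n := by simp [pre]

theorem pre_succ (w : ℕ → A) (n : ℕ) : pre w (n + 1) = pre w n ++ [w n] := by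
  simp [pre, List.range_succ]

theorem pre_add (w : ℕ → A) (m n : ℕ) : pre w (m + n) = pre w m ++ pre (fun j => w (m + j)) n := by
  simp [pre, List.range_add, Function.comp_def]

theorem take_pre (w : ℕ → A) {m n : ℕ} (h : m ≤ n) : (pre w n).take m = pre w m := by
  obtain ⟨k, rfl⟩ := Nat.exists_eq_add_of_le h
  rw [pre_add, List.take_left' (length_pre w m)]

theorem get_pre (w : ℕ → A) (n : ℕ) (i : Fin (pre w n).length) : (pre w n).get i = w i := by
  rw [List.get_eq_getElem]
  simp [pre]

theorem pre_eq_pre_iff {w w' : ℕ → A} {n : ℕ} : pre w n = pre w' n ↔ ∀ i < n, w i = w' i := by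
  simp [pre]

theorem wordMT_append (u v : List A) : wordMT F (u ++ v) = wordMT F u * wordMT F v := by
  simp [wordMT]

theorem wordMT_pre_succ (w : ℕ → A) (n : ℕ) :
    wordMT F (pre w (n + 1)) = wordMT F (pre w n) * F (w n) := by
  rw [pre_succ, wordMT_append]
  simp [wordMT]

/-- The points `F_{w_{[0,i)}}⁻¹ x`. -/
noncomputable def traj (w : ℕ → A) (x : Circle) (i : ℕ) : Circle :=
  onCircle (wordMT F (pre w i))⁻¹ x

theorem traj_zero (w : ℕ → A) (x : Circle) : traj F w x 0 = x := by
  simp [traj, pre, wordMT, onCircle_one]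

theorem traj_succ (w : ℕ → A) (x : Circle) (i : ℕ) :
    traj F w x (i + 1) = onCircle (F (w i))⁻¹ (traj F w x i) := by
  rw [traj, wordMT_pre_succ, mul_inv_rev, onCircle_mul, traj]

theorem traj_add (w : ℕ → A) (x : Circle) (m i : ℕ) :
    traj F w x (m + i) = traj F (fun j => w (m + j)) (traj F w x m) i := by
  rw [traj, pre_add, wordMT_append, mul_inv_rev, onCircle_mul, traj, traj]

theorem onCircle_traj (w : ℕ → A) (x : Circle) (i : ℕ) :
    onCircle (wordMT F (pre w i)) (traj F w x i) = x :=
  onCircle_onCircle_inv _ x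

theorem onCircle_traj_succ (w : ℕ → A) (x : Circle) (i : ℕ) :
    onCircle (F (w i)) (traj F w x (i + 1)) = traj F w x i := by
  rw [traj_succ, onCircle_onCircle_inv]

theorem dil_pre_succ (w : ℕ → A) (x : Circle) (n : ℕ) :
    dil (wordMT F (pre w (n + 1)))⁻¹ x
      = dil (F (w n))⁻¹ (traj F w x n) * dil (wordMT F (pre w n))⁻¹ x := by
  rw [wordMT_pre_succ, mul_inv_rev, dil_mul _ _ x.norm_coe.le]
  rfl

/-- Membership in W_u becomes an itinerary condition on the backward orbit of x. -/
theorem mem_refined_pre (w : ℕ → A) (n : ℕ) (x : Circle) :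
    x ∈ refined F W (pre w n) ↔ ∀ i < n, traj F w x i ∈ W (w i) := by
  simp only [refined, Set.mem_iInter, mem_image_onCircle, get_pre]
  constructor
  · intro h i hi
    have := h ⟨i, by simpa using hi⟩
    rwa [take_pre w hi.le] at this
  · intro h i
    have hi : (i : ℕ) < n := by simpa using i.2
    rw [take_pre w hi.le]
    exact h i hi

theorem refined_pre_anti (w : ℕ → A) : Antitone fun n => refined F W (pre w n) := by
  intro m n hmn x hx
  rw [mem_refined_pre] at hx ⊢
  exact fun i hi => hx i (hi.trans_le hmn)

theorem traj_mem_closure {w : ℕ → A} {n : ℕ} {x : Circle}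
    (hx : x ∈ closure (refined F W (pre w n))) {i : ℕ} (hi : i < n) :
    traj F w x i ∈ closure (W (w i)) := by
  rw [traj, ← mem_image_onCircle, ← closure_image_onCircle]
  refine closure_mono (fun z hz => ?_) hx
  rw [mem_image_onCircle]
  exact (mem_refined_pre F W w n z).1 hz i hi

theorem traj_mem_refined {w : ℕ → A} {m n : ℕ} {x : Circle} (hx : x ∈ refined F W (pre w (m + n))) :
    traj F w x m ∈ refined F W (pre (fun j => w (m + j)) n) := by
  rw [mem_refined_pre] at hx ⊢
  intro i hi
  rw [← traj_add]
  exact hx _ (by omega)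

theorem traj_mem_closure_refined {w : ℕ → A} {m n : ℕ} {x : Circle}
    (hx : x ∈ closure (refined F W (pre w (m + n)))) :
    traj F w x m ∈ closure (refined F W (pre (fun j => w (m + j)) n)) := by
  rw [traj, ← mem_image_onCircle, ← closure_image_onCircle]
  refine closure_mono (fun z hz => ?_) hx
  rw [mem_image_onCircle]
  exact traj_mem_refined F W hz

/-! ### Trajectories along which the dilation tends to one -/

/-- On the compact complement of U the function |dil - 1| has a positive lower bound. -/
theorem eventually_mem_of_dil (g : DiscMT) {U : Set Circle} (hU : IsOpen U)
    (h : ∀ z : Circle, dil g z = 1 → z ∈ U) :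
    ∀ᶠ k in 𝓝 (1 : ℝ), ∀ z : Circle, dil g z = k → z ∈ U := by
  have hcont : Continuous fun z : Circle => |dil g z - 1| :=
    ((continuous_dil g).sub continuous_const).abs
  obtain ⟨δ, hδ, hle⟩ := (hU.isClosed_compl.isCompact).exists_forall_le' hcont.continuousOn
    (a := 0) fun z hz => abs_pos.2 (sub_ne_zero.2 fun e => hz (h z e))
  filter_upwards [Metric.ball_mem_nhds (1 : ℝ) hδ] with k hk z hz
  by_contra hzU
  have := hle z hzU
  rw [hz] at this
  rw [Metric.mem_ball, Real.dist_eq] at hk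
  linarith

theorem exists_separation {X : Type*} [MetricSpace X] {s : Set X} (hs : s.Finite) :
    ∃ η : ℝ, 0 < η ∧ ∀ x ∈ s, ∀ y ∈ s, dist x y < η → x = y := by
  obtain ⟨C, hC, h⟩ := hs.relatively_discrete
  have hC' : min C 1 ≠ ⊤ := (lt_of_le_of_lt (min_le_right C 1) ENNReal.one_lt_top).ne
  refine ⟨(min C 1).toReal, ENNReal.toReal_pos (lt_min hC one_pos).ne' hC', fun x hx y hy hxy => ?_⟩
  by_contra hne
  have h1 := h x hx y hy hne
  have h2 : edist x y < min C 1 := by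
    rw [edist_dist]
    exact (ENNReal.ofReal_lt_iff_lt_toReal dist_nonneg hC').2 hxy
  exact absurd (h1.trans_lt (h2.trans_le (min_le_left _ _))) (lt_irrefl _)

variable [Finite A]

/-- If the dilation factors along a trajectory are at least one and tend to one, they are
eventually equal to one. -/
theorem eventually_dil_eq_one (w : ℕ → A) (x : ℕ → Circle)
    (hx : ∀ i, x (i + 1) = onCircle (F (w i))⁻¹ (x i))
    (h1 : ∀ i, 1 ≤ dil (F (w i))⁻¹ (x i))
    (hlim : Tendsto (fun i => dil (F (w i))⁻¹ (x i)) atTop (𝓝 1))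
    (hne : ∀ i, (F (w i))⁻¹.1 1 0 ≠ 0) :
    ∃ N, ∀ i ≥ N, dil (F (w i))⁻¹ (x i) = 1 := by
  let E : A → Set Circle := fun a => {z | dil (F a)⁻¹ z = 1}
  -- The images are included so that the point near x_{i+1} and the image of the point near x_i
  -- belong to one finite, hence separated, set.
  let E' : Set Circle := ⋃ a ∈ {a | (F a)⁻¹.1 1 0 ≠ 0}, (E a ∪ onCircle (F a)⁻¹ '' E a)
  have hE' : E'.Finite := (Set.toFinite _).biUnion fun a ha =>
    (finite_dil_eq_one _ ha).union ((finite_dil_eq_one _ ha).image _)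
  obtain ⟨η, hη, hsep⟩ := exists_separation hE'
  have hmem {i : ℕ} {e : Circle} (he : e ∈ E (w i)) : e ∈ E' :=
    Set.mem_biUnion (hne i) (Or.inl he)
  have hmem' {i : ℕ} {e : Circle} (he : e ∈ E (w i)) : onCircle (F (w i))⁻¹ e ∈ E' :=
    Set.mem_biUnion (hne i) (Or.inr ⟨e, he, rfl⟩)
  have hclose : ∀ ε > 0, ∃ N, ∀ i ≥ N, ∃ e ∈ E (w i), dist (x i) e < ε ∧
      dist (x (i + 1)) (onCircle (F (w i))⁻¹ e) < ε := by
    intro ε hε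
    let U : A → Set Circle := fun a => ⋃ e ∈ E a,
      {z | dist z e < ε ∧ dist (onCircle (F a)⁻¹ z) (onCircle (F a)⁻¹ e) < ε}
    have hU (a : A) : IsOpen (U a) := by
      refine isOpen_biUnion fun e _ => ?_
      have hc := continuous_onCircle (F a)⁻¹
      exact (isOpen_lt (continuous_id.dist continuous_const) continuous_const).inter
        (isOpen_lt (hc.dist continuous_const) continuous_const)
    have hEU (a : A) : ∀ z : Circle, dil (F a)⁻¹ z = 1 → z ∈ U a := fun z hz =>
      Set.mem_biUnion (show z ∈ E a from hz) (by simpa using hε)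
    have hev : ∀ᶠ k in 𝓝 (1 : ℝ), ∀ a, ∀ z : Circle, dil (F a)⁻¹ z = k → z ∈ U a :=
      eventually_all.2 fun a => eventually_mem_of_dil _ (hU a) (hEU a)
    obtain ⟨N, hN⟩ := eventually_atTop.1 (hlim.eventually hev)
    refine ⟨N, fun i hi => ?_⟩
    obtain ⟨e, he, hz⟩ := Set.mem_iUnion₂.1 (hN i hi (w i) (x i) rfl)
    refine ⟨e, he, hz.1, ?_⟩
    rw [hx]
    exact hz.2
  obtain ⟨N, hN⟩ := hclose (η / 2) (by positivity)
  choose! e he hd hd' using hN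
  -- Both points are within η/2 of x_{i+1}, so separation identifies them.
  have hstep : ∀ i ≥ N, e (i + 1) = onCircle (F (w i))⁻¹ (e i) := by
    intro i hi
    refine hsep _ (hmem (he _ (hi.trans (Nat.le_succ i)))) _ (hmem' (he i hi)) ?_
    have h2 := hd (i + 1) (hi.trans (Nat.le_succ i))
    have h3 := hd' i hi
    rw [dist_comm] at h2
    linarith [dist_triangle (e (i + 1)) (x (i + 1)) (onCircle (F (w i))⁻¹ (e i))]
  -- Each step multiplies the squared distance by dil(x_j) · dil(e_j), which is ≥ 1. Since the
  -- distance also becomes arbitrarily small, it must vanish.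
  have hmono : ∀ i ≥ N, ∀ j ≥ i, dist (x i) (e i) ≤ dist (x j) (e j) := by
    intro i hi j hj
    induction j, hj using Nat.le_induction with
    | base => exact le_rfl
    | succ j hj ih =>
      refine ih.trans ?_
      rw [hx, hstep j (hi.trans hj)]
      refine (pow_le_pow_iff_left₀ dist_nonneg dist_nonneg two_ne_zero).1 ?_
      rw [dist_onCircle_sq, show dil (F (w j))⁻¹ (e j) = 1 from he j (hi.trans hj), mul_one]
      exact le_mul_of_one_le_left (by positivity) (h1 j)
  refine ⟨N, fun i hi => ?_⟩
  suffices x i = e i by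
    rw [this]
    exact he i hi
  by_contra hxe
  obtain ⟨M, hM⟩ := hclose (min (η / 2) (dist (x i) (e i)))
    (lt_min (by positivity) (dist_pos.2 hxe))
  obtain ⟨e', he', hde', -⟩ := hM (max i M) (le_max_right _ _)
  have hj : N ≤ max i M := hi.trans (le_max_left _ _)
  have heq : e' = e (max i M) := by
    refine hsep _ (hmem he') _ (hmem (he _ hj)) ?_
    have h2 := hd _ hj
    have h3 := hde'.trans_le (min_le_left _ _)
    rw [dist_comm] at h3
    linarith [dist_triangle e' (x (max i M)) (e (max i M))]
  rw [heq] at hde'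
  exact absurd (hde'.trans_le (min_le_right _ _)) (hmono i hi _ (le_max_left _ _)).not_gt

theorem exists_pos_le_of_ne_zero (f : A → ℝ) (hf : ∀ a, 0 ≤ f a) :
    ∃ δ > 0, ∀ a, f a ≠ 0 → δ ≤ f a := by
  classical
  cases isEmpty_or_nonempty A
  · exact ⟨1, one_pos, fun a => isEmptyElim a⟩
  -- The zeros are replaced by 1 so that the minimum is positive.
  · obtain ⟨a, ha⟩ := Finite.exists_min fun a => if f a = 0 then 1 else f a
    refine ⟨_, ?_, fun b hb => (ha b).trans_eq (if_neg hb)⟩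
    split_ifs with h
    · exact one_pos
    · exact (hf a).lt_of_ne' h

end Words

section Convergence

variable {A : Type*} {F : A → DiscMT} {W : A → Set Circle}

/-! ### The parabolic case -/

/-- Composing the translations along a trajectory with dilation factors one. -/
theorem translation_pre {w : ℕ → A} {x : Circle} {t : ℕ → ℝ}
    (ht : ∀ i, ∀ z : ℂ, ‖z‖ ≤ 1 → z ≠ traj F w x (i + 1) →
      (traj F w x i : ℂ) / (traj F w x i - mob (F (w i)).1 z)
        = traj F w x (i + 1) / (traj F w x (i + 1) - z) + t i * Complex.I) (n : ℕ) :
    ∀ z : ℂ, ‖z‖ ≤ 1 → z ≠ traj F w x n →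
      (x : ℂ) / (x - mob (wordMT F (pre w n)).1 z)
        = traj F w x n / (traj F w x n - z) + (∑ i ∈ Finset.range n, t i : ℝ) * Complex.I := by
  induction n with
  | zero =>
    intro z _ _
    have h1 : wordMT F (pre w 0) = 1 := by simp [wordMT, pre]
    rw [h1, mob_one, traj_zero]
    simp
  | succ n ih =>
    intro z hz hzn
    have hne : mob (F (w n)).1 z ≠ traj F w x n := by
      intro h
      apply hzn
      rw [← mob_inv_mob (F (w n)) hz, h, traj_succ, coe_onCircle]
    rw [wordMT_pre_succ, mob_mul _ _ hz, ih _ (norm_mob_le _ hz) hne, ht n z hz hzn,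
      Finset.sum_range_succ]
    push_cast
    ring

/-- Since `dil g⁻¹ x = 1`, the distance identity reads (1/4 + τ²)/`dil g⁻¹ z` = 1/4 + (τ - t)².
Expansion at z therefore means (τ - t)² < τ². -/
theorem sq_lt_of_mem_expansionInterval {g : DiscMT} {x z : Circle} {t : ℝ}
    (hx : dil g⁻¹ x = 1) (hz : z ∈ expansionInterval g) (hzx : z ≠ x)
    (ht : tau (onCircle g⁻¹ x) (onCircle g⁻¹ z) = tau x z - t) : t ^ 2 < 2 * (t * tau x z) := by
  have hne : onCircle g⁻¹ z ≠ onCircle g⁻¹ x := fun h =>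
    hzx ((circleHomeo g⁻¹).injective h)
  have h1 := inv_dist_sq x z hzx
  have h2 := inv_dist_sq _ _ hne
  have hz' : 1 < dil g⁻¹ z := hz
  rw [dist_onCircle_sq, hx, one_mul, mul_inv, h1, ht] at h2
  have h3 : (dil g⁻¹ z)⁻¹ < 1 := inv_lt_one_of_one_lt₀ hz'
  have h4 : (dil g⁻¹ z)⁻¹ * (1 / 4 + tau x z ^ 2) < 1 * (1 / 4 + tau x z ^ 2) :=
    mul_lt_mul_of_pos_right h3 (by positivity)
  nlinarith

theorem exists_mem_refined_tau_gt {s : Set Circle} {x : Circle} (hx : x ∈ closure s) (hxs : x ∉ s)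
    (M : ℝ) : ∃ z ∈ s, z ≠ x ∧ M < |tau x z| := by
  have hpos : (0 : ℝ) < 1 / 4 + M ^ 2 := by positivity
  obtain ⟨z, hz, hd⟩ := Metric.mem_closure_iff.1 hx (Real.sqrt (1 / 4 + M ^ 2)⁻¹) (by positivity)
  have hzx : z ≠ x := fun h => hxs (h ▸ hz)
  refine ⟨z, hz, hzx, ?_⟩
  have h1 := inv_dist_sq x z hzx
  have h2 : dist x z ^ 2 < (1 / 4 + M ^ 2)⁻¹ := (Real.lt_sqrt dist_nonneg).1 hd
  have h3 : 0 < dist x z ^ 2 := by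
    have := dist_pos.2 hzx.symm
    positivity
  have h4 := (lt_inv_comm₀ h3 hpos).1 h2
  rw [h1] at h4
  refine lt_of_le_of_lt (le_abs_self M) (sq_lt_sq.1 ?_)
  linarith

theorem traj_ne {w : ℕ → A} {x z : Circle} (h : z ≠ x) (i : ℕ) : traj F w z i ≠ traj F w x i :=
  fun e => h ((circleHomeo (wordMT F (pre w i))⁻¹).injective e)

theorem tendsto_of_dil_eq_one [Finite A] (hWV : ∀ a, W a ⊆ expansionInterval (F a))
    {w : ℕ → A} {x : Circle}
    (hx : ∀ n, x ∈ closure (refined F W (pre w n)))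
    (hk : ∀ i, dil (F (w i))⁻¹ (traj F w x i) = 1) :
    Tendsto (fun n => mob (wordMT F (pre w n)).1 0) atTop (𝓝 (x : ℂ)) := by
  have hex (i : ℕ) : ∃ t : ℝ, ∀ z : ℂ, ‖z‖ ≤ 1 → z ≠ traj F w x (i + 1) →
      (traj F w x i : ℂ) / (traj F w x i - mob (F (w i)).1 z)
        = traj F w x (i + 1) / (traj F w x (i + 1) - z) + t * Complex.I := by
    have h1 := dil_inv_mob (F (w i)) (traj F w x (i + 1)).norm_coe.le
    rw [← coe_onCircle, onCircle_traj_succ, hk, one_mul] at h1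
    have h2 := exists_translation _ _ h1
    rwa [← coe_onCircle, onCircle_traj_succ] at h2
  choose t ht using hex
  set T : ℕ → ℝ := fun n => ∑ i ∈ Finset.range n, t i with hT
  have htrans := translation_pre ht
  have htau (z : Circle) (hz : z ≠ x) (i : ℕ) :
      tau (traj F w x i) (traj F w z i) = tau x z - T i := by
    have h1 := htrans i (traj F w z i) (traj F w z i).norm_coe.le
      fun e => traj_ne hz i (Circle.ext e)
    rw [← coe_onCircle, onCircle_traj] at h1
    rw [tau, tau, h1]
    simp [hT]
  have hsign (n : ℕ) : ∃ s : ℝ, ∀ i ≤ n, 0 < t i * s := by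
    -- Expansion is strict on W but the dilation along x is exactly 1, so x is only a limit of the
    -- refined set and `tau x` is unbounded there.
    have hxn : x ∉ refined F W (pre w (n + 1)) := by
      intro h
      have h0 := hWV _ ((mem_refined_pre F W w _ x).1 h 0 n.succ_pos)
      have h1 : 1 < dil (F (w 0))⁻¹ (traj F w x 0) := h0
      rw [hk] at h1
      exact lt_irrefl _ h1
    obtain ⟨z, hz, hzx, hS⟩ := exists_mem_refined_tau_gt (hx (n + 1)) hxn
      (∑ i ∈ Finset.range n, |t i|)
    -- |τ(z)| exceeds every partial sum |T i| with i ≤ n, so τ(z) - T i keeps the sign of τ(z), and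
    -- expansion at step i gives t i that same sign.
    refine ⟨tau x z, fun i hi => ?_⟩
    have hzi := hWV _ ((mem_refined_pre F W w _ z).1 hz i (by omega))
    have h1 := sq_lt_of_mem_expansionInterval (t := t i) (hk i) hzi (traj_ne hzx i) (by
      rw [← traj_succ, ← traj_succ, htau z hzx, htau z hzx]
      simp only [hT, Finset.sum_range_succ]
      ring)
    rw [htau z hzx] at h1
    have hTi : |T i| < |tau x z| := by
      refine lt_of_le_of_lt ((Finset.abs_sum_le_sum_abs _ _).trans ?_) hS
      exact Finset.sum_le_sum_of_subset_of_nonneg (Finset.range_subset_range.2 hi)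
        fun _ _ _ => abs_nonneg _
    have h2 : 0 < t i * (tau x z - T i) := by nlinarith [sq_nonneg (t i)]
    rcases le_total 0 (tau x z) with h0 | h0
    · rw [abs_of_nonneg h0] at hTi
      have h3 : 0 < tau x z - T i := by linarith [le_abs_self (T i)]
      have h4 := pos_of_mul_pos_left h2 h3.le
      have h5 : 0 < tau x z := (abs_nonneg _).trans_lt hTi
      positivity
    · rw [abs_of_nonpos h0] at hTi
      have h3 : tau x z - T i < 0 := by linarith [neg_abs_le (T i)]
      have h4 : t i < 0 := by
        by_contra! h
        linarith [mul_nonpos_of_nonneg_of_nonpos h h3.le]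
      have h5 : tau x z < 0 := by linarith [abs_nonneg (T i)]
      exact mul_pos_of_neg_of_neg h4 h5
  have hsame (i j : ℕ) : 0 < t i * t j := by
    obtain ⟨s, hs⟩ := hsign (max i j)
    have h1 := hs i (le_max_left _ _)
    have h2 := hs j (le_max_right _ _)
    have h3 : 0 < (t i * t j) * s ^ 2 := by
      have := mul_pos h1 h2
      linarith [show t i * s * (t j * s) = (t i * t j) * s ^ 2 by ring]
    exact pos_of_mul_pos_left h3 (sq_nonneg s)
  obtain ⟨δ, hδ, hδle⟩ := exists_pos_le_of_ne_zero (fun a => ‖mob (F a).1 0‖)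
    fun _ => norm_nonneg _
  -- If F_{w_i} fixed 0, evaluating the translation formula at 0 would give t i = 0, against the
  -- common sign.
  have htδ (i : ℕ) : δ ≤ |t i| := by
    have hti : t i ≠ 0 := fun h => by simpa [h] using hsame i i
    have hti' := ht i
    rw [← onCircle_traj_succ F w x i] at hti'
    have hle := norm_mob_zero_le_of_translation hti'
    refine (hδle (w i) fun h0 => hti ?_).trans hle
    have h1 := ht i 0 (by simp) (Circle.coe_ne_zero _).symm
    rw [norm_eq_zero.1 h0, sub_zero, sub_zero, div_self (Circle.coe_ne_zero _),
      div_self (Circle.coe_ne_zero _)] at h1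
    simpa using h1
  have hTabs (n : ℕ) : |T n| = ∑ i ∈ Finset.range n, |t i| := by
    rcases lt_or_gt_of_ne (show t 0 ≠ 0 from fun h => by simpa [h] using hsame 0 0) with h0 | h0
    · have hneg (i : ℕ) : t i < 0 := by
        by_contra! h
        linarith [hsame i 0, mul_nonpos_of_nonneg_of_nonpos h h0.le]
      rw [abs_of_nonpos (Finset.sum_nonpos fun i _ => (hneg i).le), ← Finset.sum_neg_distrib]
      exact Finset.sum_congr rfl fun i _ => (abs_of_neg (hneg i)).symm
    · have hpos (i : ℕ) : 0 < t i := pos_of_mul_pos_left (hsame i 0) h0.le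
      rw [abs_of_nonneg (Finset.sum_nonneg fun i _ => (hpos i).le)]
      exact Finset.sum_congr rfl fun i _ => (abs_of_pos (hpos i)).symm
  have hTn (n : ℕ) : n * δ ≤ |T n| := by
    rw [hTabs]
    calc _ = ∑ _i ∈ Finset.range n, δ := by simp
      _ ≤ _ := Finset.sum_le_sum fun i _ => htδ i
  rw [tendsto_iff_norm_sub_tendsto_zero]
  have hlim : Tendsto (fun n : ℕ => ((n : ℝ) * δ)⁻¹) atTop (𝓝 0) :=
    tendsto_inv_atTop_zero.comp (tendsto_natCast_atTop_atTop.atTop_mul_const hδ)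
  refine squeeze_zero' (Eventually.of_forall fun _ => norm_nonneg _) ?_ hlim
  filter_upwards [eventually_gt_atTop 0] with n hn
  have hnδ : 0 < n * δ := by positivity
  have h1 := htrans n 0 (by simp) (Circle.coe_ne_zero _).symm
  rw [sub_zero, div_self (Circle.coe_ne_zero _)] at h1
  have h2 : ‖(x : ℂ) / (x - mob (wordMT F (pre w n)).1 0)‖ = ‖1 + (T n : ℂ) * Complex.I‖ := by
    rw [h1]
  rw [norm_div, x.norm_coe, one_div] at h2
  rw [norm_sub_rev, ← inv_inv ‖(x : ℂ) - _‖, h2]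
  refine inv_anti₀ hnδ ((hTn n).trans ?_)
  have := Complex.abs_im_le_norm (1 + (T n : ℂ) * Complex.I)
  simpa using this

/-! ### Convergence -/

theorem one_le_dil_of_mem_closure (hWV : ∀ a, W a ⊆ expansionInterval (F a)) {a : A} {x : Circle}
    (hx : x ∈ closure (W a)) : 1 ≤ dil (F a)⁻¹ x := by
  have hcl : IsClosed {x : Circle | 1 ≤ dil (F a)⁻¹ x} :=
    isClosed_le continuous_const (continuous_dil _)
  have hsub : W a ⊆ {x : Circle | 1 ≤ dil (F a)⁻¹ x} := fun z hz =>
    (show 1 < dil (F a)⁻¹ z from hWV a hz).le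
  exact closure_minimal hsub hcl hx

/-- The images of the centre converge to any common point of the closed refined sets. -/
theorem tendsto_of_mem_closure_refined [Finite A] (hWV : ∀ a, W a ⊆ expansionInterval (F a))
    {w : ℕ → A} {x : Circle} (hx : ∀ n, x ∈ closure (refined F W (pre w n))) :
    Tendsto (fun n => mob (wordMT F (pre w n)).1 0) atTop (𝓝 (x : ℂ)) := by
  have hcl (i : ℕ) : traj F w x i ∈ closure (W (w i)) :=
    traj_mem_closure F W (hx (i + 1)) i.lt_succ_self
  have hk (i : ℕ) : 1 ≤ dil (F (w i))⁻¹ (traj F w x i) := one_le_dil_of_mem_closure hWV (hcl i)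
  -- A rotation expands nowhere, so its W would be empty.
  have hne (i : ℕ) : (F (w i))⁻¹.1 1 0 ≠ 0 := by
    intro h
    obtain ⟨z, hz⟩ := closure_nonempty_iff.1 ⟨_, hcl i⟩
    have h1 : 1 < dil (F (w i))⁻¹ z := hWV _ hz
    rw [dil_eq_one_of_apply_zero _ h] at h1
    exact lt_irrefl _ h1
  set K : ℕ → ℝ := fun n => dil (wordMT F (pre w n))⁻¹ x with hK
  have hKsucc (n : ℕ) : K (n + 1) = dil (F (w n))⁻¹ (traj F w x n) * K n := dil_pre_succ F w x n
  have hKpos (n : ℕ) : 0 < K n := dil_pos _ x.norm_coe.le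
  have hmono : Monotone K := monotone_nat_of_le_succ fun n => by
    rw [hKsucc]
    exact le_mul_of_one_le_left (hKpos n).le (hk n)
  rcases tendsto_atTop_of_monotone hmono with hinf | ⟨l, hl⟩
  · have hsq : Tendsto (fun n => ‖(x : ℂ) - mob (wordMT F (pre w n)).1 0‖ ^ 2) atTop (𝓝 0) := by
      refine squeeze_zero (fun _ => by positivity) (fun n => ?_) (tendsto_inv_atTop_zero.comp hinf)
      show _ ≤ (K n)⁻¹
      rw [← one_div, le_div_iff₀ (hKpos n)]
      exact norm_sub_mob_zero_sq_le _ x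
    rw [tendsto_iff_norm_sub_tendsto_zero]
    have := hsq.sqrt
    simpa [Real.sqrt_sq, norm_sub_rev] using this
  · have hlpos : 0 < l := (hKpos 0).trans_le (hmono.ge_of_tendsto hl 0)
    have hlim : Tendsto (fun i => dil (F (w i))⁻¹ (traj F w x i)) atTop (𝓝 1) := by
      have h1 := ((tendsto_add_atTop_iff_nat 1).2 hl).div hl hlpos.ne'
      rw [div_self hlpos.ne'] at h1
      refine h1.congr fun n => ?_
      rw [Pi.div_apply, hKsucc, mul_div_cancel_right₀ _ (hKpos n).ne']
    obtain ⟨N, hN⟩ := eventually_dil_eq_one F w (traj F w x) (traj_succ F w x) hk hlim hne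
    -- Restart the trajectory at time N; continuity of G_N at x_N carries the limit back to x.
    have h2 := tendsto_of_dil_eq_one hWV (w := fun j => w (N + j)) (x := traj F w x N)
      (fun n => traj_mem_closure_refined F W (hx (N + n)))
      (fun i => by
        rw [← traj_add]
        exact hN _ (Nat.le_add_right _ _))
    have hcont := (hasDerivAt_mob (wordMT F (pre w N)) (traj F w x N).norm_coe.le).continuousAt
    have h3 := hcont.tendsto.comp h2
    rw [← coe_onCircle, onCircle_traj] at h3
    refine (tendsto_add_atTop_iff_nat N).1 (h3.congr fun n => ?_)
    rw [Function.comp_apply, ← mob_mul _ _ (by simp), ← wordMT_append, ← pre_add, add_comm]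

theorem Phi_eq_of_represents {w : ℕ → A} {x : Circle}
    (h : Represents (fun n => wordMT F (pre w n)) x) : w ∈ domain F ∧ Phi F w = x := by
  have hd : w ∈ domain F := ⟨x, h⟩
  refine ⟨hd, ?_⟩
  rw [Phi, dif_pos hd]
  exact hd.choose_spec.unique h

theorem Phi_eq_of_mem_closure_refined [Finite A] (hWV : ∀ a, W a ⊆ expansionInterval (F a))
    {w : ℕ → A} {x : Circle} (hx : ∀ n, x ∈ closure (refined F W (pre w n))) : w ∈ domain F ∧ Phi F w = x :=
  Phi_eq_of_represents (represents_of_tendsto (tendsto_of_mem_closure_refined hWV hx))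

theorem exists_mem_closure_refined {w : ℕ → A} (hw : ∀ n, (refined F W (pre w n)).Nonempty) :
    ∃ x, ∀ n, x ∈ closure (refined F W (pre w n)) := by
  obtain ⟨x, hx⟩ := IsCompact.nonempty_iInter_of_directed_nonempty_isCompact_isClosed
    (fun n => closure (refined F W (pre w n)))
    (directed_of_isDirected_le fun _ _ h => closure_mono (refined_pre_anti F W w h))
    (fun n => (hw n).closure) (fun _ => isClosed_closure.isCompact) fun _ => isClosed_closure
  exact ⟨x, Set.mem_iInter.1 hx⟩

/-- Every common point of the closures is represented by `w`, and a sequence represents at most one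
point. -/
theorem Phi_mem_closure_refined [Finite A] (hWV : ∀ a, W a ⊆ expansionInterval (F a)) {w : ℕ → A}
    (hw : ∀ n, (refined F W (pre w n)).Nonempty) (n : ℕ) :
    Phi F w ∈ closure (refined F W (pre w n)) := by
  obtain ⟨x, hx⟩ := exists_mem_closure_refined hw
  rw [(Phi_eq_of_mem_closure_refined hWV hx).2]
  exact hx n

/-! ### The interval shift -/

section Topology

variable [TopologicalSpace A] [DiscreteTopology A]

theorem isOpen_pre_eq (w : ℕ → A) (n : ℕ) : IsOpen {w' : ℕ → A | pre w' n = pre w n} := by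
  simp only [pre_eq_pre_iff]
  have : {w' : ℕ → A | ∀ i < n, w' i = w i}
      = ⋂ i ∈ Set.Iio n, (fun w' : ℕ → A => w' i) ⁻¹' {w i} := by
    ext
    simp
  rw [this]
  exact (Set.finite_Iio n).isOpen_biInter fun i _ =>
    (isOpen_discrete {w i}).preimage (continuous_apply i)

theorem isClosed_pre (n : ℕ) (p : List A → Prop) : IsClosed {w : ℕ → A | p (pre w n)} := by
  rw [← isOpen_compl_iff, isOpen_iff_mem_nhds]
  intro w hw
  filter_upwards [(isOpen_pre_eq w n).mem_nhds rfl] with w' hw'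
  have hw'' : pre w' n = pre w n := hw'
  simpa [hw''] using hw

theorem isSubshift_intervalShift {S : Set (ℕ → A)} (hS : IsSubshift S) :
    IsSubshift (intervalShift F W S) := by
  refine ⟨?_, fun w hw => ⟨hS.2 hw.1, fun n => ?_⟩⟩
  · have : intervalShift F W S
        = S ∩ ⋂ n, {w : ℕ → A | (refined F W (pre w n)).Nonempty} := by
      ext
      simp [intervalShift]
    rw [this]
    exact hS.1.inter (isClosed_iInter fun n => isClosed_pre n fun u => (refined F W u).Nonempty)
  · obtain ⟨x, hx⟩ := hw.2 (1 + n)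
    have h := traj_mem_refined F W hx
    have e : (fun j => w (1 + j)) = shift w := funext fun j => by rw [shift, add_comm]
    rw [e] at h
    exact ⟨_, h⟩

/-- The closed refined sets decrease to {Φ(w)}, so by compactness one of them lies in any given
neighbourhood; it contains Φ(w') for every w' in the shift sharing that prefix. -/
theorem continuousOn_Phi [Finite A] (hWV : ∀ a, W a ⊆ expansionInterval (F a)) (S : Set (ℕ → A)) :
    ContinuousOn (Phi F) (intervalShift F W S) := by
  intro w hw
  refine tendsto_nhds.2 fun O hO hwO => ?_
  have hU : O ∈ 𝓝 (Phi F w) := hO.mem_nhds hwO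
  obtain ⟨n, hn⟩ := exists_subset_nhds_of_compactSpace
    (V := fun n => closure (refined F W (pre w n)))
    (directed_of_isDirected_le fun _ _ h => closure_mono (refined_pre_anti F W w h))
    (fun _ => isClosed_closure) (U := O) fun x hx => by
      rwa [← (Phi_eq_of_mem_closure_refined hWV (Set.mem_iInter.1 hx)).2]
  filter_upwards [mem_nhdsWithin_of_mem_nhds ((isOpen_pre_eq w n).mem_nhds rfl),
    self_mem_nhdsWithin] with w' hw' hw'S
  have h := Phi_mem_closure_refined hWV hw'S.2 n
  rw [show pre w' n = pre w n from hw'] at h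
  exact hn h

end Topology

/-! ### Languages of subshifts -/

theorem shift_iterate_mem {S : Set (ℕ → A)} (h : Set.MapsTo shift S S) {w : ℕ → A} (hw : w ∈ S)
    (i : ℕ) : (fun j => w (i + j)) ∈ S := by
  induction i with
  | zero => simpa using hw
  | succ i ih =>
    convert h ih using 1
    funext j
    simp only [shift]
    congr 1
    ring

theorem mem_language_iff {S : Set (ℕ → A)} (h : Set.MapsTo shift S S) {v : List A} :
    v ∈ language S ↔ ∃ w ∈ S, pre w v.length = v := by
  constructor
  · rintro ⟨w, hw, i, n, rfl⟩
    exact ⟨_, shift_iterate_mem h hw i, by simp⟩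
  · rintro ⟨w, hw, hv⟩
    exact ⟨w, hw, 0, v.length, by simpa using hv.symm⟩

end Convergence

/-! ### Extension of words and images of cylinders -/

section Surjectivity

variable {A : Type*} {F : A → DiscMT} {W : A → Set Circle}

theorem exists_word_of_extension (p : List A → Prop) (h : ∀ u, p u → ∃ a, p (u ++ [a]))
    {v : List A} (hv : p v) :
    ∃ w : ℕ → A, pre w v.length = v ∧ ∀ n, p (pre w (v.length + n)) := by
  have : Nonempty A := ⟨(h v hv).choose⟩
  choose! next hnext using fun u (hu : p u) => (h u hu)
  let u : ℕ → List A := fun n => n.rec v fun _ l => l ++ [next l]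
  let w : ℕ → A := fun i => if hi : i < v.length then v[i] else next (u (i - v.length))
  have h0 : pre w v.length = v := by
    refine List.ext_getElem (by simp) fun i h1 h2 => ?_
    simp [pre, w, h2]
  have hu (n : ℕ) : pre w (v.length + n) = u n := by
    induction n with
    | zero => exact h0
    | succ n ih =>
      rw [← add_assoc, pre_succ, ih]
      simp [w, u]
  have hp (n : ℕ) : p (u n) := by
    induction n with
    | zero => exact hv
    | succ n ih => exact hnext _ ih
  exact ⟨w, h0, fun n => (hu n).symm ▸ hp n⟩

/-- Words of S agreeing with `w` on ever longer prefixes converge to `w`, and S is closed. -/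
theorem mem_of_pre_mem_language [TopologicalSpace A] {S : Set (ℕ → A)} (hS : IsSubshift S)
    {w : ℕ → A} {m : ℕ} (h : ∀ n, pre w (m + n) ∈ language S) : w ∈ S := by
  have hex (n : ℕ) : ∃ w' ∈ S, pre w' (m + n) = pre w (m + n) := by
    simpa using (mem_language_iff hS.2).1 (h n)
  choose s hs hpre using hex
  refine hS.1.mem_of_tendsto (b := atTop) (f := s) ?_ (Eventually.of_forall hs)
  refine tendsto_pi_nhds.2 fun i => tendsto_const_nhds.congr' ?_
  filter_upwards [eventually_gt_atTop i] with n hn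
  exact (pre_eq_pre_iff.1 (hpre n) i (by omega)).symm

/-- For ⊇, compatibility always supplies a next letter keeping the prefix in the language and x in
the closure; the infinite word so built has Φ-value x. -/
theorem image_Phi_cylinder [Finite A] [TopologicalSpace A]
    (hWV : ∀ a, W a ⊆ expansionInterval (F a)) {S : Set (ℕ → A)} (hS : IsSubshift S)
    (hc : IsCompatible F W S) {v : List A} (hv : v ∈ language S) :
    Phi F '' (cylinder v ∩ intervalShift F W S) = closure (refined F W v) := by
  refine Set.Subset.antisymm ?_ fun x hx => ?_
  · rintro _ ⟨w, ⟨hwv, hw⟩, rfl⟩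
    have h := Phi_mem_closure_refined hWV hw.2 v.length
    rwa [show pre w v.length = v from hwv] at h
  · obtain ⟨w, hwv, hw⟩ := exists_word_of_extension
      (fun u => u ∈ language S ∧ x ∈ closure (refined F W u)) (fun u hu => by
        have h := hu.2
        rw [hc u hu.1] at h
        obtain ⟨a, ha, hxa⟩ := Set.mem_iUnion₂.1 h
        exact ⟨a, ha, hxa⟩) ⟨hv, hx⟩
    have hxw (n : ℕ) : x ∈ closure (refined F W (pre w n)) :=
      closure_mono (refined_pre_anti F W w (Nat.le_add_left n v.length)) (hw n).2
    exact ⟨w, ⟨hwv, mem_of_pre_mem_language hS fun n => (hw n).1,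
      fun n => closure_nonempty_iff.1 ⟨x, hxw n⟩⟩, (Phi_eq_of_mem_closure_refined hWV hxw).2⟩

theorem isNumberSystem_intervalShift [Finite A] [TopologicalSpace A] [DiscreteTopology A]
    (hWV : ∀ a, W a ⊆ expansionInterval (F a)) {S : Set (ℕ → A)} (hS : IsSubshift S)
    (hne : S.Nonempty) (hc : IsCompatible F W S) :
    IsNumberSystem F (intervalShift F W S) := by
  refine ⟨isSubshift_intervalShift hS, fun w hw => ?_, ?_, continuousOn_Phi hWV S⟩
  · obtain ⟨x, hx⟩ := exists_mem_closure_refined hw.2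
    exact (Phi_eq_of_mem_closure_refined hWV hx).1
  · obtain ⟨w, hw⟩ := hne
    -- Surjectivity is the case v = λ; λ is in the language because S is nonempty.
    have h := image_Phi_cylinder hWV hS hc ((mem_language_iff hS.2).2 ⟨w, hw, rfl⟩ : [] ∈ _)
    have h1 : cylinder ([] : List A) = Set.univ := Set.eq_univ_of_forall fun w => rfl
    have h2 : refined F W [] = Set.univ :=
      Set.eq_univ_of_forall fun x => Set.mem_iInter.2 fun i => i.elim0
    rwa [h1, h2, Set.univ_inter, closure_univ] at h

end Surjectivity

end Mobius

theorem theorem3 {A : Type*} [Finite A] [TopologicalSpace A] [DiscreteTopology A]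
    (F : A → Mobius.DiscMT) (W : A → Set Circle) (S : Set (ℕ → A))
    (hW : Mobius.IsIntervalAlmostCover W)
    (hWV : ∀ a, W a ⊆ Mobius.expansionInterval (F a))
    (hS : Mobius.IsSubshift S) (hne : S.Nonempty)
    (hc : Mobius.IsCompatible F W S) :
    Mobius.IsNumberSystem F (Mobius.intervalShift F W S) ∧
      ∀ v ∈ Mobius.language S,
        Mobius.Phi F '' (Mobius.cylinder v ∩ Mobius.intervalShift F W S) =
          closure (Mobius.refined F W v) :=
  ⟨Mobius.isNumberSystem_intervalShift hWV hS hne hc,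
    fun _ hv => Mobius.image_Phi_cylinder hWV hS hc hv⟩
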